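/- For a finite simple graph $G$ let $m(G)$ be the number of perfect matchings of $G$. For an integer $d\ge 1$ let $Q_d$ be the $d$-dimensional hypercube graph (vertex set $\{0,1\}^d$, two vertices adjacent when they differ in exactly one coordinate), and put $m(d)=m(Q_d)$, $n=2^{d-1}$ and $N=(d/e)^n$. All logarithms are to base $2$. (i) Let $G$ be an $a$-regular bipartite graph with two vertex classes of size $b$ each, where $a\ge 2$. Then $$e^{b/(2a)}\left(\frac ae\right)^b\le m(G)\le\left[\sqrt{2\pi a}\cdot e^{1/(12a)}\right]^{b/a}\left(\frac ae\right)^b .$$ Moreover, for all integers $a\ge 2$ and $b\ge 0$ the upper bound satisfies $$\left[\sqrt{2\pi a}\cdot e^{1/(12a)}\right]^{b/a}\left(\frac ae\right)^b=2^{(1+\varepsilon(a,b))\cdot\log a\cdot b/(2a)}\left(\frac ae\right)^b ,$$ where $\varepsilon(a,b)\to 0$ when both $a,b\to\infty$. (ii) For the hypercube, $$e^{n/(2d)}\cdot N\le m(d)\quad\text{for all } d\ge 1,\qquad m(d)\le 2^{(1+\varepsilon_d)\cdot\log d\cdot n/(2d)}\cdot N\quad\text{for all } d\ge 2,$$ where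 $\varepsilon_d\to 0$ as $d\to\infty$. -/

import Mathlib

/-- The number `m(G)` of perfect matchings of `G`. -/
noncomputable def numPerfectMatchings {V : Type*} (G : SimpleGraph V) : ℕ :=
  Nat.card {M : G.Subgraph // M.IsPerfectMatching}

/-- The hypercube graph `Q_d` on `{0,1}^d`: two vertices are adjacent when they differ in exactly
one coordinate. -/
def hypercubeGraph (d : ℕ) : SimpleGraph (Fin d → Bool) where
  Adj x y := hammingDist x y = 1
  symm := ⟨fun x y h => by rw [hammingDist_comm]; exact h⟩
  loopless := ⟨fun x h => by simp at h⟩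

/-!
The perfect matchings of an `a`-regular bipartite graph with classes of size `b` are the
permutations supported in a `b × b` matrix with entries `0`, `1` and all row and column sums `a`,
so both bounds are bounds on a permanent.

*Lower bound.* This is Schrijver's bound `((a - 1) ^ (a - 1) / a ^ (a - 2)) ^ b`, proved by Gurvits'
method. The permanent is the coefficient of `x₁ ⋯ x_b` in the product `p` of the linear forms given
by the rows. This product does not vanish when all variables have positive real part
(`HalfPlaneStable`), and by the inequality of arithmetic and geometric means it is at least
`a ^ b ∏ xⱼ` at positive points. One replaces `p` by its coefficient of `X 0`, which has one
variable less and is stable again (`HalfPlaneStable.finSuccEquiv_coeff_one`); since `p` is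
real-rooted in `X 0` of degree at most `a`, the constant drops by at most the factor
`((a - 1) / a) ^ (a - 1)` (`le_coeff_one_of_real_roots`). After `b` steps only the coefficient is
left (`capacity_le_coeff`). The elementary estimate `exp_le_pow_pred` turns Schrijver's constant
into the exponential form. That stability is inherited rests on the inequality
`p (Re z) ≤ ‖p z‖` (`HalfPlaneStable.eval_re_le_norm`) and the Gauss–Lucas theorem.

*Upper bound.* This is the Brègman–Minc inequality `per ≤ (a!) ^ (b / a)`, proved by Schrijver's
convexity argument (`log_card_permsIn_le`), combined with `a! ≤ √(2πa) (a/e)^a e^(1/(12a))`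
(`factorial_le_stirling`).

The hypercube `Q_d` is `d`-regular and bipartite, the classes being the vertices of even and of odd
parity, with `2 ^ (d - 1)` vertices each.
-/

/-! ### Half-plane stable polynomials -/

/-- Specialising the variables of `p` one after the other: first the variables `1, …, n`, then
variable `0`. -/
theorem MvPolynomial.aeval_cons_eq_eval_map {n : ℕ} {A : Type*} [CommRing A] [Algebra ℝ A]
    (p : MvPolynomial (Fin (n + 1)) ℝ) (t : A) (z : Fin n → A) :
    MvPolynomial.aeval (Fin.cons t z : Fin (n + 1) → A) p =
      ((MvPolynomial.finSuccEquiv ℝ n p).map (MvPolynomial.aeval z).toRingHom).eval t := by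
  induction p using MvPolynomial.induction_on with
  | C a => simp [MvPolynomial.finSuccEquiv_apply]
  | add p q hp hq => simp [hp, hq]
  | mul_X p i hp =>
    rw [map_mul, map_mul, hp, Polynomial.map_mul, Polynomial.eval_mul]
    congr 1
    refine Fin.cases ?_ (fun j => ?_) i
    · simp [MvPolynomial.finSuccEquiv_X_zero]
    · simp [MvPolynomial.finSuccEquiv_X_succ]

/-- A real polynomial is *half-plane stable* if it does not vanish when all variables lie in the
open right half-plane. -/
def HalfPlaneStable {σ : Type*} (p : MvPolynomial σ ℝ) : Prop :=
  ∀ z : σ → ℂ, (∀ i, 0 < (z i).re) → MvPolynomial.aeval z p ≠ 0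

/-- All coefficients of the polynomial are nonnegative. -/
def NonnegCoeffs {σ : Type*} (p : MvPolynomial σ ℝ) : Prop := ∀ m, 0 ≤ p.coeff m

theorem aeval_ofReal {σ : Type*} (p : MvPolynomial σ ℝ) (x : σ → ℝ) :
    MvPolynomial.aeval (fun i => (x i : ℂ)) p = ((MvPolynomial.eval x p : ℝ) : ℂ) := by
  have := MvPolynomial.aeval_algebraMap_apply ℂ x p
  simpa [Function.comp_def, MvPolynomial.aeval_eq_eval] using this

theorem NonnegCoeffs.eval_nonneg {σ : Type*} {p : MvPolynomial σ ℝ} (hp : NonnegCoeffs p)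
    {x : σ → ℝ} (hx : ∀ i, 0 ≤ x i) : 0 ≤ MvPolynomial.eval x p := by
  rw [MvPolynomial.eval_eq]
  exact Finset.sum_nonneg fun m _ => mul_nonneg (hp m)
    (Finset.prod_nonneg fun i _ => pow_nonneg (hx i) _)

theorem NonnegCoeffs.eval_pos {σ : Type*} {p : MvPolynomial σ ℝ} (hp : NonnegCoeffs p)
    (h0 : p ≠ 0) {x : σ → ℝ} (hx : ∀ i, 0 < x i) : 0 < MvPolynomial.eval x p := by
  rw [MvPolynomial.eval_eq]
  refine Finset.sum_pos (fun m hm => mul_pos ?_ (Finset.prod_pos fun i _ => pow_pos (hx i) _))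
    (MvPolynomial.support_nonempty.2 h0)
  exact lt_of_le_of_ne (hp m) (Ne.symm (MvPolynomial.mem_support_iff.1 hm))

theorem NonnegCoeffs.finSuccEquiv_coeff {n : ℕ} {p : MvPolynomial (Fin (n + 1)) ℝ}
    (hp : NonnegCoeffs p) (i : ℕ) : NonnegCoeffs ((MvPolynomial.finSuccEquiv ℝ n p).coeff i) := by
  intro m
  rw [MvPolynomial.finSuccEquiv_coeff_coeff]
  exact hp _

theorem aeval_smul_of_isHomogeneous {σ : Type*} {p : MvPolynomial σ ℝ} {n : ℕ}
    (hp : p.IsHomogeneous n) (c : ℂ) (z : σ → ℂ) :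
    MvPolynomial.aeval (fun i => c * z i) p = c ^ n * MvPolynomial.aeval z p := by
  rw [MvPolynomial.aeval_def, MvPolynomial.eval₂_eq, MvPolynomial.aeval_def,
    MvPolynomial.eval₂_eq, Finset.mul_sum]
  refine Finset.sum_congr rfl fun m hm => ?_
  have hdeg : ∑ i ∈ m.support, m i = n := by
    have := hp (MvPolynomial.mem_support_iff.1 hm)
    simpa [Finsupp.weight_apply, Finsupp.sum] using this
  simp_rw [mul_pow, Finset.prod_mul_distrib, Finset.prod_pow_eq_pow_sum, hdeg]
  ring

/-- By homogeneity, a stable polynomial has no zeros on any open half-space obtained from the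
right half-space by a rotation. -/
theorem HalfPlaneStable.aeval_ne_zero_of_rotate {σ : Type*} {p : MvPolynomial σ ℝ} {n : ℕ}
    (hs : HalfPlaneStable p) (hp : p.IsHomogeneous n) (c : ℂ) {z : σ → ℂ}
    (hz : ∀ i, 0 < (c * z i).re) : MvPolynomial.aeval z p ≠ 0 := by
  intro h
  apply hs _ hz
  rw [aeval_smul_of_isHomogeneous hp, h, mul_zero]

/-- A polynomial with only real roots is at least as large at `i` as at `0`, because `i` is at
least as far from each root as `0`. -/
theorem norm_eval_zero_le_norm_eval_I (g : Polynomial ℂ) (hg : ∀ r ∈ g.roots, r.im = 0) :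
    ‖g.eval 0‖ ≤ ‖g.eval Complex.I‖ := by
  have hsplit := (IsAlgClosed.splits g).eq_prod_roots
  have key : ∀ s : Multiset ℂ, (∀ r ∈ s, r.im = 0) →
      ‖((s.map fun r => Polynomial.X - Polynomial.C r).prod).eval 0‖ ≤
        ‖((s.map fun r => Polynomial.X - Polynomial.C r).prod).eval Complex.I‖ := by
    intro s
    induction s using Multiset.induction_on with
    | empty => simp
    | cons r s ih =>
      intro hs
      have h1 := ih fun r hr => hs r (Multiset.mem_cons_of_mem hr)
      have h2 : ‖(0 : ℂ) - r‖ ≤ ‖Complex.I - r‖ := by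
        have hr := hs r (Multiset.mem_cons_self r s)
        rw [Complex.norm_def, Complex.norm_def]
        apply Real.sqrt_le_sqrt
        simp [Complex.normSq_apply, hr]
      simp only [Multiset.map_cons, Multiset.prod_cons, Polynomial.eval_mul, norm_mul,
        Polynomial.eval_sub, Polynomial.eval_X, Polynomial.eval_C]
      exact mul_le_mul h2 h1 (norm_nonneg _) (norm_nonneg _)
  rw [hsplit, Polynomial.eval_mul, Polynomial.eval_mul, norm_mul, norm_mul, Polynomial.eval_C,
    Polynomial.eval_C]
  exact mul_le_mul_of_nonneg_left (key _ hg) (norm_nonneg _)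

/-- On the right half-space, a homogeneous stable polynomial is smallest at the real points:
`p (Re z) ≤ ‖p z‖`. With `z = x + i y`, the polynomial `s ↦ p (x + s y)` has only real roots, and
it is compared at `s = 0` and `s = i`. -/
theorem HalfPlaneStable.eval_re_le_norm {σ : Type*} {p : MvPolynomial σ ℝ} {n : ℕ}
    (hs : HalfPlaneStable p) (hp : p.IsHomogeneous n) {z : σ → ℂ}
    (hz : ∀ i, 0 < (z i).re) :
    MvPolynomial.eval (fun i => (z i).re) p ≤ ‖MvPolynomial.aeval z p‖ := by
  let g : Polynomial ℂ := MvPolynomial.aeval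
    (fun i => Polynomial.C ((z i).re : ℂ) + Polynomial.X * Polynomial.C ((z i).im : ℂ)) p
  have hg : ∀ s : ℂ, g.eval s = MvPolynomial.aeval (fun i => ((z i).re : ℂ) + (z i).im * s) p := by
    intro s
    have := MvPolynomial.aeval_unique
      ((Polynomial.aeval s : Polynomial ℂ →ₐ[ℂ] ℂ).restrictScalars ℝ |>.comp
        (MvPolynomial.aeval
        (fun i => Polynomial.C ((z i).re : ℂ) + Polynomial.X * Polynomial.C ((z i).im : ℂ))))
    have := DFunLike.congr_fun this p
    simpa [Function.comp_def, g, Polynomial.coe_aeval_eq_eval] using this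
  have h := norm_eval_zero_le_norm_eval_I g ?_
  · have h0 : g.eval 0 = ((MvPolynomial.eval (fun i => (z i).re) p : ℝ) : ℂ) := by
      rw [hg, ← aeval_ofReal]; simp
    have hI : g.eval Complex.I = MvPolynomial.aeval z p := by
      rw [hg]
      congr 2
      funext i
      exact Complex.re_add_im (z i)
    rw [h0, hI, Complex.norm_real] at h
    exact (le_abs_self _).trans h
  · intro r hr
    by_contra him
    have hr0 : g.eval r = 0 := (Polynomial.mem_roots'.1 hr).2
    rw [hg] at hr0
    -- multiplying `x + r y` by `Im r * i / r` gives real part `x (Im r)² / |r|²`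
    refine hs.aeval_ne_zero_of_rotate hp ((r.im : ℂ) * Complex.I * r⁻¹) (fun i => ?_) hr0
    have hrne : r ≠ 0 := by rintro rfl; simp at him
    have : (r.im : ℂ) * Complex.I * r⁻¹ * (((z i).re : ℂ) + (z i).im * r) =
        (r.im : ℂ) * Complex.I * r⁻¹ * ((z i).re : ℂ) + Complex.I * ((r.im * (z i).im : ℝ) : ℂ) := by
      push_cast
      field_simp
    rw [this]
    have hn : 0 < Complex.normSq r := Complex.normSq_pos.2 hrne
    have h3 : 0 < r.im * (r.im / Complex.normSq r) * (z i).re := by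
      have : 0 < r.im * r.im := mul_self_pos.2 him
      rw [← mul_div_assoc]
      exact mul_pos (div_pos this hn) (hz i)
    simpa [Complex.inv_re, Complex.inv_im, neg_div] using h3

/-- If the roots of `F` lie in the open left half-plane and `F` is not constant, then `F' (0) ≠ 0`,
by the Gauss–Lucas theorem. -/
theorem coeff_one_ne_zero_of_roots_re_neg (F : Polynomial ℂ) (hF : 0 < F.degree)
    (h : ∀ r, F.eval r = 0 → r.re < 0) : F.coeff 1 ≠ 0 := by
  intro h1
  have hder : F.derivative.eval 0 = 0 := by
    rw [← Polynomial.coeff_zero_eq_eval_zero, Polynomial.coeff_derivative]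
    simp [h1]
  have hd0 : F.derivative ≠ 0 := by
    intro h0
    have := Polynomial.derivative_eq_zero.1 h0
    have h2 := Polynomial.natDegree_pos_iff_degree_pos.2 hF
    omega
  have hmem : (0 : ℂ) ∈ convexHull ℝ (F.rootSet ℂ) := by
    apply Polynomial.rootSet_derivative_subset_convexHull_rootSet hF
    rw [Polynomial.mem_rootSet]
    exact ⟨hd0, by simpa [Polynomial.coe_aeval_eq_eval] using hder⟩
  have hconv : Convex ℝ {w : ℂ | w.re < 0} := convex_halfSpace_re_lt 0
  have hsub : convexHull ℝ (F.rootSet ℂ) ⊆ {w : ℂ | w.re < 0} := by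
    apply convexHull_min _ hconv
    intro w hw
    rw [Polynomial.mem_rootSet] at hw
    exact h w (by simpa [Polynomial.coe_aeval_eq_eval] using hw.2)
  have := hsub hmem
  simp at this

/-- Stability is inherited by the coefficient of `X 0`, that is, by the partial derivative along
`X 0` restricted to `X 0 = 0`. -/
theorem HalfPlaneStable.finSuccEquiv_coeff_one {n m : ℕ} {p : MvPolynomial (Fin (n + 1)) ℝ}
    (hs : HalfPlaneStable p) (hp : p.IsHomogeneous m) (hnn : NonnegCoeffs p)
    (hq : (MvPolynomial.finSuccEquiv ℝ n p).coeff 1 ≠ 0) :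
    HalfPlaneStable ((MvPolynomial.finSuccEquiv ℝ n p).coeff 1) := by
  intro z hz
  set P := MvPolynomial.finSuccEquiv ℝ n p with hP
  set F : Polynomial ℂ := P.map (MvPolynomial.aeval z).toRingHom with hF
  set x : Fin n → ℝ := fun i => (z i).re with hx
  set f : Polynomial ℝ := P.map (MvPolynomial.eval x) with hf
  have hFeval : ∀ t, F.eval t = MvPolynomial.aeval (Fin.cons t z : Fin (n + 1) → ℂ) p := fun t =>
    (MvPolynomial.aeval_cons_eq_eval_map p t z).symm
  have hfeval : ∀ t, f.eval t = MvPolynomial.eval (Fin.cons t x : Fin (n + 1) → ℝ) p := fun t =>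
    (MvPolynomial.eval_eq_eval_mv_eval' x t p).symm
  have hfcoeff : ∀ i, f.coeff i = MvPolynomial.eval x (P.coeff i) := fun i => by simp [hf]
  have hFcoeff : ∀ i, F.coeff i = MvPolynomial.aeval z (P.coeff i) := fun i => by simp [hF]
  have hfnn : ∀ i, 0 ≤ f.coeff i := fun i => by
    rw [hfcoeff]
    exact (hnn.finSuccEquiv_coeff i).eval_nonneg fun i => (hz i).le
  have hf1 : 0 < f.coeff 1 := by
    rw [hfcoeff]; exact (hnn.finSuccEquiv_coeff 1).eval_pos hq hz
  have hdom : ∀ t : ℂ, 0 < t.re → f.eval t.re ≤ ‖F.eval t‖ := by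
    intro t ht
    rw [hfeval, hFeval]
    have hc : ∀ i, 0 < ((Fin.cons t z : Fin (n + 1) → ℂ) i).re :=
      Fin.cases (by simpa using ht) (by simpa using hz)
    convert hs.eval_re_le_norm hp hc using 3
    funext i
    refine Fin.cases ?_ (fun j => ?_) i <;> simp [hx]
  have hdom' : ∀ t : ℂ, 0 ≤ t.re → f.eval t.re ≤ ‖F.eval t‖ := by
    intro t ht
    have h1 : Filter.Tendsto (fun e : ℝ => f.eval (t + (e : ℂ)).re) (nhdsWithin 0 (Set.Ioi 0))
        (nhds (f.eval t.re)) := by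
      have : Continuous fun e : ℝ => f.eval (t + (e : ℂ)).re := by fun_prop
      simpa using (this.tendsto 0).mono_left nhdsWithin_le_nhds
    have h2 : Filter.Tendsto (fun e : ℝ => ‖F.eval (t + (e : ℂ))‖) (nhdsWithin 0 (Set.Ioi 0))
        (nhds ‖F.eval t‖) := by
      have : Continuous fun e : ℝ => ‖F.eval (t + (e : ℂ))‖ := by fun_prop
      simpa using (this.tendsto 0).mono_left nhdsWithin_le_nhds
    refine le_of_tendsto_of_tendsto h1 h2 ?_
    filter_upwards [self_mem_nhdsWithin] with e he
    exact hdom _ (by simpa using add_pos_of_nonneg_of_pos ht he)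
  -- nonnegative coefficients give `f t ≥ f 0 + t f' (0)`
  have hflow : ∀ t : ℝ, 0 ≤ t → f.coeff 0 + f.coeff 1 * t ≤ f.eval t := by
    intro t ht
    rw [Polynomial.eval_eq_sum_range' (n := f.natDegree + 2) (by omega)]
    have : Finset.range 2 ⊆ Finset.range (f.natDegree + 2) := by
      intro i; simp; omega
    refine le_trans (le_of_eq ?_) (Finset.sum_le_sum_of_subset_of_nonneg this
      fun i _ _ => mul_nonneg (hfnn i) (pow_nonneg ht i))
    simp [Finset.sum_range_succ]
  rw [← hFcoeff]
  rcases (hfnn 0).eq_or_lt with h0 | h0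
  · have hP0 : P.coeff 0 = 0 := by
      by_contra hne
      have := (hnn.finSuccEquiv_coeff 0).eval_pos hne hz
      rw [hfcoeff] at h0
      exact absurd h0 this.ne
    have hFX : F = Polynomial.X * F.divX := by
      conv_lhs => rw [← Polynomial.X_mul_divX_add F]
      simp [hFcoeff, hP0]
    have hle : f.coeff 1 ≤ ‖F.divX.eval 0‖ := by
      have h2 : Filter.Tendsto (fun e : ℝ => ‖F.divX.eval (e : ℂ)‖) (nhdsWithin 0 (Set.Ioi 0))
          (nhds ‖F.divX.eval 0‖) := by
        have : Continuous fun e : ℝ => ‖F.divX.eval (e : ℂ)‖ := by fun_prop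
        simpa using (this.tendsto 0).mono_left nhdsWithin_le_nhds
      refine ge_of_tendsto h2 ?_
      filter_upwards [self_mem_nhdsWithin] with e he
      have he : 0 < e := he
      have h3 := hdom' (e : ℂ) (by simpa using he.le)
      rw [hFX, Polynomial.eval_mul, Polynomial.eval_X, norm_mul, Complex.norm_real,
        Complex.ofReal_re, Real.norm_of_nonneg he.le] at h3
      have h4 := hflow e he.le
      rw [← h0] at h4
      have : e * f.coeff 1 ≤ e * ‖F.divX.eval (e : ℂ)‖ := by linarith
      exact le_of_mul_le_mul_left this he
    rw [← Polynomial.coeff_zero_eq_eval_zero, Polynomial.coeff_divX] at hle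
    intro h
    rw [zero_add, h, norm_zero] at hle
    linarith
  · apply coeff_one_ne_zero_of_roots_re_neg
    · by_contra hdeg
      have hconst := Polynomial.eq_C_of_degree_le_zero (not_lt.1 hdeg)
      set c := F.coeff 0
      have ht : 0 ≤ ‖c‖ / f.coeff 1 := by positivity
      have h1 := hdom' ((‖c‖ / f.coeff 1 : ℝ) : ℂ) (by rw [Complex.ofReal_re]; exact ht)
      rw [hconst, Polynomial.eval_C, Complex.ofReal_re] at h1
      have h2 := hflow _ ht
      rw [mul_div_cancel₀ _ hf1.ne'] at h2
      linarith
    · intro r hr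
      by_contra hre
      have h1 := hdom' r (not_lt.1 hre)
      rw [hr, norm_zero] at h1
      have h2 := hflow _ (not_lt.1 hre)
      have h3 := mul_nonneg hf1.le (not_lt.1 hre)
      linarith

/-! ### Capacity of stable polynomials -/

/-- The inequality of arithmetic and geometric means in the form `∏ (1 + t / l) ≤ (1 + t S / k) ^ k`
with `S = ∑ 1 / l`, for at most `k` factors. -/
theorem prod_one_add_le_pow (s : Multiset ℝ) (hs : ∀ l ∈ s, 0 < l) {t : ℝ} (ht : 0 ≤ t) {k : ℕ}
    (hk : 1 ≤ k) (hcard : Multiset.card s ≤ k) :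
    (s.map fun l => 1 + t * l⁻¹).prod ≤ (1 + t * (s.map fun l => l⁻¹).sum / k) ^ k := by
  have hS : 0 ≤ (s.map fun l => l⁻¹).sum := by
    apply Multiset.sum_nonneg
    intro x hx
    obtain ⟨l, hl, rfl⟩ := Multiset.mem_map.1 hx
    exact (inv_pos.2 (hs l hl)).le
  set S := (s.map fun l => l⁻¹).sum with hSdef
  set m := t * S / k with hm
  have hm0 : 0 ≤ m := by positivity
  have hm1 : 0 < 1 + m := by positivity
  -- tangent line bound at the mean: `1 + x ≤ (1 + m) exp ((x - m) / (1 + m))`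
  have htan : ∀ x : ℝ, 1 + x ≤ (1 + m) * Real.exp ((x - m) / (1 + m)) := by
    intro x
    have := Real.add_one_le_exp ((x - m) / (1 + m))
    have h2 : 1 + x = (1 + m) * ((x - m) / (1 + m) + 1) := by field_simp; ring
    rw [h2]
    exact mul_le_mul_of_nonneg_left this hm1.le
  have key : ∀ u : Multiset ℝ, (∀ l ∈ u, 0 < l) →
      (u.map fun l => 1 + t * l⁻¹).prod ≤ (1 + m) ^ (Multiset.card u) *
        Real.exp ((t * (u.map fun l => l⁻¹).sum - Multiset.card u * m) / (1 + m)) := by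
    intro u
    induction u using Multiset.induction_on with
    | empty => simp
    | cons l u ih =>
      intro hu
      have h1 := ih fun r hr => hu r (Multiset.mem_cons_of_mem hr)
      have hl : 0 < l := hu l (Multiset.mem_cons_self l u)
      simp only [Multiset.map_cons, Multiset.prod_cons, Multiset.sum_cons, Multiset.card_cons]
      have h0 : 0 ≤ 1 + t * l⁻¹ := by positivity
      refine (mul_le_mul_of_nonneg_left h1 h0).trans
        ((mul_le_mul_of_nonneg_right (htan _) (by positivity)).trans (le_of_eq ?_))
      rw [pow_succ, mul_mul_mul_comm, ← Real.exp_add, mul_comm (1 + m)]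
      congr 2
      push_cast
      ring
  refine (key s hs).trans ?_
  have hone : 1 ≤ (1 + m) * Real.exp ((0 - m) / (1 + m)) := by simpa using htan 0
  have hkm : t * S = k * m := by
    have : (k : ℝ) ≠ 0 := by positivity
    rw [hm]; field_simp
  obtain ⟨e, rfl⟩ := Nat.exists_eq_add_of_le hcard
  refine (le_mul_of_one_le_right (by positivity) (one_le_pow₀ hone (n := e))).trans (le_of_eq ?_)
  rw [mul_pow, mul_mul_mul_comm, ← pow_add, ← Real.exp_nat_mul, ← Real.exp_add, hkm]
  have : ((((Multiset.card s + e : ℕ) : ℝ) * m - Multiset.card s * m) / (1 + m) +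
      e * ((0 - m) / (1 + m))) = 0 := by
    push_cast
    ring
  rw [this, Real.exp_zero, mul_one]

theorem coeff_prod_X_add_C (s : Multiset ℝ) (hs : ∀ l ∈ s, 0 < l) :
    0 < ((s.map fun l => Polynomial.X + Polynomial.C l).prod).coeff 0 ∧
    ((s.map fun l => Polynomial.X + Polynomial.C l).prod).coeff 1 =
      ((s.map fun l => Polynomial.X + Polynomial.C l).prod).coeff 0 * (s.map fun l => l⁻¹).sum ∧
    ∀ t : ℝ, ((s.map fun l => Polynomial.X + Polynomial.C l).prod).eval t =
      ((s.map fun l => Polynomial.X + Polynomial.C l).prod).coeff 0 *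
        (s.map fun l => 1 + t * l⁻¹).prod := by
  induction s using Multiset.induction_on with
  | empty => simp [Polynomial.coeff_one]
  | cons l s ih =>
    obtain ⟨h0, h1, h2⟩ := ih fun r hr => hs r (Multiset.mem_cons_of_mem hr)
    have hl : 0 < l := hs l (Multiset.mem_cons_self l s)
    simp only [Multiset.map_cons, Multiset.prod_cons, Multiset.sum_cons, add_mul,
      Polynomial.coeff_add, Polynomial.coeff_X_mul_zero, Polynomial.coeff_C_mul,
      Polynomial.coeff_X_mul, Polynomial.eval_add, Polynomial.eval_mul, Polynomial.eval_X,
      Polynomial.eval_C, zero_add]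
    refine ⟨mul_pos hl h0, ?_, fun t => ?_⟩
    · rw [h1]; field_simp
    · rw [h2]; field_simp; ring

/-- A real polynomial whose complex roots are all real and nonpositive is a product of linear
factors `X + l` with `l ≥ 0`. -/
theorem exists_eq_prod_X_add_C (f : Polynomial ℝ)
    (hroots : ∀ r : ℂ, (f.map Complex.ofRealHom).eval r = 0 → ∃ l : ℝ, 0 ≤ l ∧ r = -(l : ℂ)) :
    f = 0 ∨ ∃ s : Multiset ℝ, (∀ l ∈ s, 0 ≤ l) ∧
      f = Polynomial.C f.leadingCoeff * (s.map fun l => Polynomial.X + Polynomial.C l).prod := by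
  by_cases hf : f = 0
  · exact Or.inl hf
  right
  set F := f.map Complex.ofRealHom with hF
  have hrt : ∀ r ∈ F.roots, 0 ≤ -r.re ∧ r = -((-r.re : ℝ) : ℂ) := by
    intro r hr
    obtain ⟨l, hl, rfl⟩ := hroots r (Polynomial.mem_roots'.1 hr).2
    simpa using hl
  refine ⟨F.roots.map fun r => -r.re, ?_, ?_⟩
  · intro l hl
    obtain ⟨r, hr, rfl⟩ := Multiset.mem_map.1 hl
    exact (hrt r hr).1
  · apply Polynomial.map_injective Complex.ofRealHom Complex.ofRealHom.injective
    rw [Polynomial.map_mul, Polynomial.map_C, Polynomial.map_multiset_prod, Multiset.map_map,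
      Multiset.map_map]
    have hsplit := (IsAlgClosed.splits F).eq_prod_roots
    conv_lhs => rw [← hF, hsplit]
    congr 1
    · rw [hF, Polynomial.leadingCoeff_map]
    · congr 1
      apply Multiset.map_congr rfl
      intro r hr
      have := (hrt r hr).2
      simp only [Function.comp_apply, Polynomial.map_add, Polynomial.map_X, Polynomial.map_C,
        Complex.ofRealHom_eq_coe]
      conv_lhs => rw [this]
      simp [sub_eq_add_neg]

/-- The univariate step: if `f t ≥ c t` for `t > 0`, and `f` has degree at most `k` and only real
nonpositive roots, then `f' (0) ≥ c ((k - 1) / k) ^ (k - 1)`. -/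
theorem le_coeff_one_of_real_roots (f : Polynomial ℝ) {k : ℕ} (hk : 1 ≤ k) (hdeg : f.natDegree ≤ k)
    (hnn : 0 ≤ f.coeff 0)
    (hroots : ∀ r : ℂ, (f.map Complex.ofRealHom).eval r = 0 → ∃ l : ℝ, 0 ≤ l ∧ r = -(l : ℂ))
    {c : ℝ} (hc : 0 < c) (h : ∀ t, 0 < t → c * t ≤ f.eval t) :
    (((k : ℝ) - 1) / k) ^ (k - 1) * c ≤ f.coeff 1 := by
  have hk0 : (0 : ℝ) < k := by exact_mod_cast hk
  have hk1 : (0 : ℝ) ≤ (k : ℝ) - 1 := by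
    have : (1 : ℝ) ≤ k := by exact_mod_cast hk
    linarith
  rcases hnn.eq_or_lt with h0 | h0
  · have hle : c ≤ f.coeff 1 := by
      have hfX : f = Polynomial.X * f.divX := by
        conv_lhs => rw [← Polynomial.X_mul_divX_add f]
        simp [← h0]
      have h2 : Filter.Tendsto (fun e : ℝ => f.divX.eval e) (nhdsWithin 0 (Set.Ioi 0))
          (nhds (f.divX.eval 0)) :=
        (f.divX.continuous.tendsto 0).mono_left nhdsWithin_le_nhds
      have h3 : c ≤ f.divX.eval 0 := by
        refine ge_of_tendsto h2 ?_
        filter_upwards [self_mem_nhdsWithin] with e he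
        have he : 0 < e := he
        have h4 := h e he
        rw [hfX, Polynomial.eval_mul, Polynomial.eval_X, mul_comm] at h4
        exact le_of_mul_le_mul_left h4 he
      rwa [← Polynomial.coeff_zero_eq_eval_zero, Polynomial.coeff_divX, zero_add] at h3
    refine le_trans (mul_le_of_le_one_left hc.le (pow_le_one₀ (by positivity) ?_)) hle
    rw [div_le_one hk0]
    linarith
  · rcases exists_eq_prod_X_add_C f hroots with hf | ⟨s, hs, hf⟩
    · simp [hf] at h0
    have hspos : ∀ l ∈ s, 0 < l := by
      intro l hl
      refine (hs l hl).lt_of_ne fun hl0 => ?_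
      obtain ⟨u, rfl⟩ := Multiset.exists_cons_of_mem hl
      rw [hf] at h0
      simp [← hl0] at h0
    obtain ⟨hp0, hp1, hpt⟩ := coeff_prod_X_add_C s hspos
    have hcard : Multiset.card s ≤ k := by
      refine le_trans (le_of_eq ?_) hdeg
      have hlc : f.leadingCoeff ≠ 0 := by
        rw [Polynomial.leadingCoeff_ne_zero]
        rintro rfl
        simp at h0
      rw [hf, Polynomial.natDegree_C_mul hlc, Polynomial.natDegree_multiset_prod_of_monic]
      · simp
      · intro q hq
        obtain ⟨l, _, rfl⟩ := Multiset.mem_map.1 hq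
        exact Polynomial.monic_X_add_C l
    set S := (s.map fun l => l⁻¹).sum with hS
    have hS0 : 0 ≤ S := by
      apply Multiset.sum_nonneg
      intro x hx
      obtain ⟨l, hl, rfl⟩ := Multiset.mem_map.1 hx
      exact (inv_pos.2 (hspos l hl)).le
    have hc1 : f.coeff 1 = f.coeff 0 * S := by
      rw [hf, Polynomial.coeff_C_mul, Polynomial.coeff_C_mul, hp1, mul_assoc]
    have hupper : ∀ t, 0 < t → c * t ≤ f.coeff 0 * (1 + t * S / k) ^ k := by
      intro t ht
      refine (h t ht).trans ?_
      have : f.eval t = f.coeff 0 * (s.map fun l => 1 + t * l⁻¹).prod := by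
        rw [hf, Polynomial.eval_mul, Polynomial.eval_C, Polynomial.coeff_C_mul, hpt, mul_assoc]
      rw [this]
      exact mul_le_mul_of_nonneg_left (prod_one_add_le_pow s hspos ht.le hk hcard) h0.le
    have hSpos : 0 < S := by
      refine hS0.lt_of_ne fun hS' => ?_
      have := hupper ((f.coeff 0 + 1) / c) (by positivity)
      rw [← hS', mul_div_cancel₀ _ hc.ne'] at this
      simp at this
      linarith
    rw [hc1]
    obtain ⟨j, rfl⟩ : ∃ j, k = j + 1 := ⟨k - 1, by omega⟩
    rcases Nat.eq_zero_or_pos j with rfl | hj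
    · -- in degree one the slope of `f` is at least `c`
      by_contra hlt
      simp at hlt
      have := hupper (f.coeff 0 / (c - f.coeff 0 * S) + 1)
        (by have := sub_pos.2 hlt; positivity)
      have hd := sub_pos.2 hlt
      simp at this
      have h5 : (c - f.coeff 0 * S) * (f.coeff 0 / (c - f.coeff 0 * S) + 1) ≤ f.coeff 0 := by
        nlinarith
      rw [mul_add, mul_div_cancel₀ _ hd.ne'] at h5
      linarith
    · -- the minimum of `(1 + t S / k) ^ k / t` is at `t = k / (S (k - 1))`
      have hj0 : (0 : ℝ) < j := by exact_mod_cast hj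
      have hmin := hupper ((j + 1) / (S * j)) (by positivity)
      push_cast at hmin ⊢
      have e1 : (1 + (((j : ℝ) + 1) / (S * j)) * S / (j + 1)) = (j + 1) / j := by
        field_simp
      rw [e1] at hmin
      simp only [add_sub_cancel_right]
      have hq : ((j : ℝ) / (j + 1)) ^ j * (((j : ℝ) + 1) / j) ^ j = 1 := by
        rw [← mul_pow]
        have : (j : ℝ) / (j + 1) * ((j + 1) / j) = 1 := by field_simp
        rw [this, one_pow]
      have h6 : c * ((j + 1) / (S * j)) * (((j : ℝ) / (j + 1)) ^ j * (S * j / (j + 1))) ≤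
          f.coeff 0 * (((j : ℝ) + 1) / j) ^ (j + 1) * (((j : ℝ) / (j + 1)) ^ j * (S * j / (j + 1))) :=
        mul_le_mul_of_nonneg_right hmin (by positivity)
      have e2 : c * ((j + 1) / (S * j)) * (((j : ℝ) / (j + 1)) ^ j * (S * j / (j + 1))) =
          ((j : ℝ) / (j + 1)) ^ j * c := by field_simp
      have e3 : f.coeff 0 * (((j : ℝ) + 1) / j) ^ (j + 1) *
          (((j : ℝ) / (j + 1)) ^ j * (S * j / (j + 1))) =
          f.coeff 0 * S * (((j : ℝ) / (j + 1)) ^ j * (((j : ℝ) + 1) / j) ^ j) := by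
        rw [pow_succ]
        generalize ((j : ℝ) / (j + 1)) ^ j = A
        generalize (((j : ℝ) + 1) / j) ^ j = B
        field_simp
      rw [e2, e3, hq, mul_one] at h6
      exact h6

/-- Gurvits' capacity inequality: if a homogeneous stable polynomial of degree `n` in `n` variables
has degree at most `k` in each variable and dominates `c ∏ xᵢ`, then its multilinear coefficient is
at least `c ((k - 1) / k) ^ ((k - 1) n)`. The variables are removed one at a time. -/
theorem capacity_le_coeff {k : ℕ} (hk : 1 ≤ k) {c : ℝ} (hc : 0 < c) (n : ℕ)
    (p : MvPolynomial (Fin n) ℝ) (hp : p.IsHomogeneous n) (hnn : NonnegCoeffs p)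
    (hs : HalfPlaneStable p) (hdeg : ∀ j, p.degreeOf j ≤ k)
    (h : ∀ x : Fin n → ℝ, (∀ i, 0 < x i) → c * ∏ i, x i ≤ MvPolynomial.eval x p) :
    ((((k : ℝ) - 1) / k) ^ (k - 1)) ^ n * c ≤ p.coeff (Finsupp.equivFunOnFinite.symm fun _ => 1) := by
  have hk0 : (0 : ℝ) < k := by exact_mod_cast hk
  have hk1 : (0 : ℝ) ≤ (k : ℝ) - 1 := by
    have : (1 : ℝ) ≤ k := by exact_mod_cast hk
    linarith
  have hg : 0 < (((k : ℝ) - 1) / k) ^ (k - 1) := by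
    rcases Nat.eq_or_lt_of_le hk with rfl | hk2
    · simp
    · have : (1 : ℝ) < k := by exact_mod_cast hk2
      have : 0 < (k : ℝ) - 1 := by linarith
      positivity
  set g := (((k : ℝ) - 1) / k) ^ (k - 1) with hgdef
  induction n generalizing c with
  | zero =>
    have h0 := h (fun i => i.elim0) (fun i => i.elim0)
    rw [MvPolynomial.eq_C_of_isEmpty p] at h0 ⊢
    simp only [MvPolynomial.eval_C, Finset.univ_eq_empty, Finset.prod_empty, mul_one] at h0
    rw [pow_zero, one_mul]
    refine h0.trans (le_of_eq ?_)
    have : (Finsupp.equivFunOnFinite.symm fun _ => 1 : Fin 0 →₀ ℕ) = 0 := Subsingleton.elim _ _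
    rw [this, MvPolynomial.coeff_zero_C]
  | succ n ih =>
    set P := MvPolynomial.finSuccEquiv ℝ n p with hP
    have hqnn : NonnegCoeffs (P.coeff 1) := hnn.finSuccEquiv_coeff 1
    have hev : ∀ x : Fin n → ℝ, (∀ i, 0 < x i) →
        g * c * ∏ i, x i ≤ MvPolynomial.eval x (P.coeff 1) := by
      intro x hx
      have hprod : 0 < ∏ i, x i := Finset.prod_pos fun i _ => hx i
      have := le_coeff_one_of_real_roots (P.map (MvPolynomial.eval x)) hk
        (Polynomial.natDegree_map_le.trans
          ((MvPolynomial.natDegree_finSuccEquiv p).le.trans (hdeg 0))) ?_ ?_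
        (c := c * ∏ i, x i) (mul_pos hc hprod) ?_
      · rw [Polynomial.coeff_map] at this
        simpa [mul_assoc] using this
      · rw [Polynomial.coeff_map]
        exact (hnn.finSuccEquiv_coeff 0).eval_nonneg fun i => (hx i).le
      · intro r hr
        have hr' : MvPolynomial.aeval
            (Fin.cons r (fun i => (x i : ℂ)) : Fin (n + 1) → ℂ) p = 0 := by
          rw [MvPolynomial.aeval_cons_eq_eval_map, ← hr, Polynomial.map_map]
          congr 2
          ext i
          · simp
          · simp
        by_contra hneg
        -- rotating by the inverse of a square root moves `1` and `r` to the right half-plane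
        have hslit : r ∈ Complex.slitPlane := by
          rw [Complex.mem_slitPlane_iff]
          by_contra hcon
          push Not at hcon
          apply hneg
          refine ⟨-r.re, by linarith [hcon.1], ?_⟩
          apply Complex.ext <;> simp [hcon.2]
        have hr0 : r ≠ 0 := Complex.slitPlane_ne_zero hslit
        have hre : 0 < (Complex.exp (Complex.log r / 2)).re := by
          rw [Complex.exp_re]
          apply mul_pos (Real.exp_pos _)
          have him : (Complex.log r / 2).im = Complex.arg r / 2 := by
            rw [Complex.div_ofNat_im, Complex.log_im]
          rw [him]
          apply Real.cos_pos_of_mem_Ioo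
          have h1 := Complex.neg_pi_lt_arg r
          have h2 := (Complex.arg_le_pi r).lt_of_ne (Complex.mem_slitPlane_iff_arg.1 hslit).1
          constructor <;> linarith
        set w := Complex.exp (Complex.log r / 2) with hw
        have hww : w * w = r := by
          rw [hw, ← Complex.exp_add, add_halves, Complex.exp_log hr0]
        have hw0 : w ≠ 0 := Complex.exp_ne_zero _
        have hwinv : 0 < (w⁻¹).re := by
          rw [Complex.inv_re]
          exact div_pos hre (Complex.normSq_pos.2 hw0)
        refine hs.aeval_ne_zero_of_rotate hp w⁻¹ (Fin.cases ?_ fun i => ?_) hr'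
        · rw [Fin.cons_zero, ← hww, inv_mul_cancel_left₀ hw0]
          exact hre
        · rw [Fin.cons_succ, Complex.re_mul_ofReal]
          exact mul_pos hwinv (hx i)
      · intro t ht
        have := h (Fin.cons t x) (Fin.cases (by simpa using ht) (by simpa using hx))
        rw [MvPolynomial.eval_eq_eval_mv_eval', Fin.prod_univ_succ] at this
        simp only [Fin.cons_zero, Fin.cons_succ] at this
        refine le_trans (le_of_eq ?_) this
        ring
    have hq0 : P.coeff 1 ≠ 0 := by
      intro h0
      have := hev (fun _ => 1) (fun _ => one_pos)
      rw [h0] at this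
      simp at this
      have := mul_pos hg hc
      linarith
    have := ih (mul_pos hg hc) (P.coeff 1)
      (hp.finSuccEquiv_coeff_isHomogeneous 1 n (by omega)) hqnn
      (hs.finSuccEquiv_coeff_one hp hnn hq0)
      (fun j => (MvPolynomial.degreeOf_coeff_finSuccEquiv p j 1).trans (hdeg _)) hev
    rw [hP, MvPolynomial.finSuccEquiv_coeff_coeff] at this
    rw [pow_succ, mul_assoc]
    convert this using 2
    ext i
    refine Fin.cases ?_ (fun j => ?_) i <;> simp

/-! ### The lower bound for permutations in a regular relation -/

/-- The permutations `σ` with `σ i ∈ N i` for all `i`; their number is the permanent of the `0-1`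
matrix with rows `N i`. -/
def permsIn {V : Type*} [Fintype V] [DecidableEq V] (N : V → Finset V) : Finset (Equiv.Perm V) :=
  Finset.univ.filter fun σ => ∀ i, σ i ∈ N i

theorem mem_permsIn {V : Type*} [Fintype V] [DecidableEq V] {N : V → Finset V}
    {σ : Equiv.Perm V} : σ ∈ permsIn N ↔ ∀ i, σ i ∈ N i := by
  simp [permsIn]

theorem NonnegCoeffs.sum {σ ι : Type*} (s : Finset ι) (p : ι → MvPolynomial σ ℝ)
    (h : ∀ i ∈ s, NonnegCoeffs (p i)) : NonnegCoeffs (∑ i ∈ s, p i) := by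
  intro m
  rw [MvPolynomial.coeff_sum]
  exact Finset.sum_nonneg fun i hi => h i hi m

theorem NonnegCoeffs.prod {σ ι : Type*} (s : Finset ι) (p : ι → MvPolynomial σ ℝ)
    (h : ∀ i ∈ s, NonnegCoeffs (p i)) : NonnegCoeffs (∏ i ∈ s, p i) := by
  classical
  refine Finset.prod_induction p NonnegCoeffs (fun p q hp hq m => ?_) (fun m => ?_) h
  · rw [MvPolynomial.coeff_mul]
    exact Finset.sum_nonneg fun x _ => mul_nonneg (hp _) (hq _)
  · rw [MvPolynomial.coeff_one]
    split_ifs <;> norm_num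

theorem nonnegCoeffs_X {σ : Type*} (j : σ) : NonnegCoeffs (MvPolynomial.X j) := by
  classical
  intro m
  rw [MvPolynomial.coeff_X]
  split_ifs <;> norm_num

open MvPolynomial in
theorem coeff_one_prod_sum_X_le {n : ℕ} (N : Fin n → Finset (Fin n)) :
    (∏ i, ∑ j ∈ N i, (X j : MvPolynomial (Fin n) ℝ)).coeff
      (Finsupp.equivFunOnFinite.symm fun _ => 1) ≤ (permsIn N).card := by
  classical
  have hmon : ∀ f : Fin n → Fin n, (∏ i, (X (f i) : MvPolynomial (Fin n) ℝ)) =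
      monomial (∑ i, Finsupp.single (f i) 1) 1 := by
    intro f
    simp [X, monomial_sum_one]
  rw [Finset.prod_univ_sum, coeff_sum]
  simp_rw [hmon, coeff_monomial]
  rw [Finset.sum_boole]
  norm_cast
  apply Finset.card_le_card_of_surjOn (fun σ : Equiv.Perm (Fin n) => (σ : Fin n → Fin n))
  intro f hf
  simp only [Finset.coe_filter, Fintype.mem_piFinset, Set.mem_ofPred_eq] at hf
  have hsurj : Function.Surjective f := by
    intro j
    have h1 := DFunLike.congr_fun hf.2 j
    simp only [Finsupp.coe_finsetSum, Finset.sum_apply, Finsupp.equivFunOnFinite_symm_apply_apply]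
      at h1
    by_contra hcon
    push Not at hcon
    rw [Finset.sum_eq_zero fun i _ => Finsupp.single_eq_of_ne (hcon i).symm] at h1
    exact zero_ne_one h1
  refine ⟨Equiv.ofBijective f ⟨Finite.injective_iff_surjective.2 hsurj, hsurj⟩, ?_, rfl⟩
  exact Finset.mem_coe.2 (mem_permsIn.2 hf.1)

/-- The linear forms with `a` terms, each variable occurring in `a` of them, have product at least
`a ^ n ∏ xⱼ`, by the inequality of arithmetic and geometric means. -/
theorem pow_mul_prod_le_prod_sum {n a : ℕ} (ha : 1 ≤ a) (N : Fin n → Finset (Fin n))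
    (hrow : ∀ i, (N i).card = a) (hcol : ∀ j, (Finset.univ.filter fun i => j ∈ N i).card = a)
    (x : Fin n → ℝ) (hx : ∀ i, 0 < x i) :
    (a : ℝ) ^ n * ∏ i, x i ≤ ∏ i, ∑ j ∈ N i, x j := by
  have ha0 : (0 : ℝ) < a := by exact_mod_cast ha
  have h1 : ∀ i, (a : ℝ) * ∏ j ∈ N i, x j ^ ((a : ℝ)⁻¹) ≤ ∑ j ∈ N i, x j := by
    intro i
    have := Real.geom_mean_le_arith_mean_weighted (N i) (fun _ => (a : ℝ)⁻¹) x
      (fun _ _ => by positivity) (by simp [hrow, ha0.ne']) (fun j _ => (hx j).le)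
    rw [← Finset.mul_sum] at this
    have := mul_le_mul_of_nonneg_left this ha0.le
    rwa [mul_inv_cancel_left₀ ha0.ne'] at this
  refine le_trans (le_of_eq ?_) (Finset.prod_le_prod (fun i _ => ?_) fun i _ => h1 i)
  · rw [Finset.prod_mul_distrib, Finset.prod_const, Finset.card_univ, Fintype.card_fin]
    congr 1
    rw [Finset.prod_comm' (t' := Finset.univ) (s' := fun j => Finset.univ.filter fun i => j ∈ N i)
      (by simp)]
    refine Finset.prod_congr rfl fun j _ => ?_
    rw [Finset.prod_const, hcol, ← Real.rpow_natCast, ← Real.rpow_mul (hx j).le,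
      inv_mul_cancel₀ ha0.ne', Real.rpow_one]
  · exact mul_nonneg ha0.le (Finset.prod_nonneg fun j _ => Real.rpow_nonneg (hx j).le _)

/-- Schrijver's bound for the permanent of a `0-1` matrix with all row and column sums `a`. -/
theorem le_card_permsIn {n a : ℕ} (ha : 1 ≤ a) (N : Fin n → Finset (Fin n))
    (hrow : ∀ i, (N i).card = a) (hcol : ∀ j, (Finset.univ.filter fun i => j ∈ N i).card = a) :
    ((((a : ℝ) - 1) / a) ^ (a - 1)) ^ n * (a : ℝ) ^ n ≤ (permsIn N).card := by
  have ha0 : (0 : ℝ) < a := by exact_mod_cast ha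
  refine le_trans ?_ (coeff_one_prod_sum_X_le N)
  have hne : ∀ i, (N i).Nonempty := fun i => Finset.card_pos.1 (by rw [hrow]; omega)
  apply capacity_le_coeff ha (by positivity)
  · have := MvPolynomial.IsHomogeneous.prod Finset.univ
      (fun i => ∑ j ∈ N i, (MvPolynomial.X j : MvPolynomial (Fin n) ℝ)) (fun _ => 1)
      (fun i _ => MvPolynomial.IsHomogeneous.sum _ _ _ fun j _ => MvPolynomial.isHomogeneous_X _ _)
    simpa using this
  · exact NonnegCoeffs.prod _ _ fun i _ => NonnegCoeffs.sum _ _ fun j _ => nonnegCoeffs_X j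
  · intro z hz
    simp only [map_prod, map_sum, MvPolynomial.aeval_X]
    refine Finset.prod_ne_zero_iff.2 fun i _ h0 => ?_
    have h1 : 0 < (∑ j ∈ N i, z j).re := by
      rw [Complex.re_sum]
      exact Finset.sum_pos (fun j _ => hz j) (hne i)
    rw [h0] at h1
    simp at h1
  · intro j
    refine (MvPolynomial.degreeOf_prod_le _ _ _).trans ?_
    refine (Finset.sum_le_sum (g := fun i => if j ∈ N i then 1 else 0) fun i _ => ?_).trans ?_
    · refine (MvPolynomial.degreeOf_sum_le _ _ _).trans (Finset.sup_le fun l hl => ?_)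
      rw [MvPolynomial.degreeOf_X]
      split_ifs with h1 h2 h2
      · exact le_rfl
      · exact absurd (h1 ▸ hl) h2
      · exact Nat.zero_le _
      · exact Nat.zero_le _
    · rw [← Finset.card_filter, hcol]
  · intro x hx
    simpa using pow_mul_prod_le_prod_sum ha N hrow hcol x hx

/-- Schrijver's constant is at least `exp (-1 + 1 / (2 a))`; this is `log y ≤ (y - 1 / y) / 2` at
`y = a / (a - 1)`. -/
theorem exp_le_pow_pred {a : ℕ} (ha : 1 ≤ a) :
    Real.exp (-1 + 1 / (2 * a)) ≤ (((a : ℝ) - 1) / a) ^ (a - 1) := by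
  obtain ⟨j, rfl⟩ : ∃ j, a = j + 1 := ⟨a - 1, by omega⟩
  rcases Nat.eq_zero_or_pos j with rfl | hj
  · simp
    norm_num
  have hj0 : (0 : ℝ) < j := by exact_mod_cast hj
  push_cast
  simp only [add_sub_cancel_right]
  set y : ℝ := (j + 1) / j with hy
  have hy1 : 1 ≤ y := by rw [hy, le_div_iff₀ hj0]; linarith
  have hy0 : 0 < y := by positivity
  have hlog : Real.log y ≤ (y - y⁻¹) / 2 := by
    have := Real.self_le_sinh_iff.2 (Real.log_nonneg hy1)
    rwa [Real.sinh_eq, Real.exp_neg, Real.exp_log hy0] at this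
  have hinv : (j : ℝ) / (j + 1) = y⁻¹ := by rw [hy, inv_div]
  rw [hinv, ← Real.exp_log (inv_pos.2 hy0), ← Real.exp_nat_mul, Real.exp_le_exp, Real.log_inv]
  have h1 : (j : ℝ) * Real.log y ≤ j * ((y - y⁻¹) / 2) := mul_le_mul_of_nonneg_left hlog hj0.le
  have h2 : (j : ℝ) * ((y - y⁻¹) / 2) = 1 - 1 / (2 * (j + 1)) := by
    rw [hy]; field_simp; ring
  linarith

theorem exp_mul_pow_le_card_permsIn {n a : ℕ} (ha : 1 ≤ a) (N : Fin n → Finset (Fin n))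
    (hrow : ∀ i, (N i).card = a) (hcol : ∀ j, (Finset.univ.filter fun i => j ∈ N i).card = a) :
    Real.exp ((n : ℝ) / (2 * a)) * ((a : ℝ) / Real.exp 1) ^ n ≤ (permsIn N).card := by
  refine le_trans (le_of_eq ?_) ((mul_le_mul_of_nonneg_right
    (pow_le_pow_left₀ (Real.exp_pos _).le (exp_le_pow_pred ha) n) (by positivity)).trans
    (le_card_permsIn ha N hrow hcol))
  rw [← mul_pow, show (n : ℝ) / (2 * a) = n * (1 / (2 * a)) by ring, Real.exp_nat_mul, ← mul_pow,
    Real.exp_add, Real.exp_neg]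
  congr 1
  field_simp

/-! ### The upper bound of Brègman and Minc -/

/-- The exponent `log (r!) / r` of the Brègman–Minc bound. -/
noncomputable def logFactorialDiv (r : ℕ) : ℝ := Real.log (r.factorial) / r

theorem mul_logFactorialDiv (r : ℕ) : (r : ℝ) * logFactorialDiv r = Real.log (r.factorial) := by
  rcases Nat.eq_zero_or_pos r with rfl | hr
  · simp
  · have : (r : ℝ) ≠ 0 := by positivity
    rw [logFactorialDiv, mul_div_cancel₀ _ this]

/-- Convexity of `x log x`: the log sum inequality against the uniform weights. -/
theorem sum_mul_log_sum_le {ι : Type*} (s : Finset ι) (t : ι → ℝ) (ht : ∀ i ∈ s, 0 ≤ t i)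
    (hpos : 0 < ∑ i ∈ s, t i) :
    (∑ i ∈ s, t i) * Real.log (∑ i ∈ s, t i) ≤
      (∑ i ∈ s, t i) * Real.log s.card + ∑ i ∈ s, t i * Real.log (t i) := by
  have hne : s.Nonempty := by
    by_contra h
    rw [Finset.not_nonempty_iff_eq_empty.1 h] at hpos
    simp at hpos
  have hc : (0 : ℝ) < s.card := by exact_mod_cast Finset.card_pos.2 hne
  have h := Real.convexOn_mul_log.map_sum_le (t := s) (w := fun _ => (s.card : ℝ)⁻¹) (p := t)
    (fun _ _ => by positivity) (by simp [hc.ne']) (fun i hi => ht i hi)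
  simp only [smul_eq_mul, ← Finset.mul_sum] at h
  have h2 := mul_le_mul_of_nonneg_left h hc.le
  rw [mul_inv_cancel_left₀ hc.ne', mul_assoc, mul_inv_cancel_left₀ hc.ne',
    Real.log_mul (by positivity) hpos.ne', Real.log_inv] at h2
  linarith

/-- The relation `N` with the value `k` forced at `i`, and removed elsewhere. -/
def forceValue {V : Type*} [DecidableEq V] (N : V → Finset V) (i k : V) : V → Finset V :=
  fun j => if j = i then {k} else (N j).erase k

theorem mem_permsIn_forceValue {V : Type*} [Fintype V] [DecidableEq V] {N : V → Finset V} {i k : V}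
    (hk : k ∈ N i) {σ : Equiv.Perm V} :
    σ ∈ permsIn (forceValue N i k) ↔ σ ∈ permsIn N ∧ σ i = k := by
  rw [mem_permsIn, mem_permsIn]
  constructor
  · intro h
    have hi : σ i = k := by simpa [forceValue] using h i
    refine ⟨fun j => ?_, hi⟩
    by_cases hj : j = i
    · rw [hj, hi]; exact hk
    · have := h j
      simp only [forceValue, if_neg hj] at this
      exact Finset.mem_of_mem_erase this
  · rintro ⟨h, hi⟩ j
    by_cases hj : j = i
    · simp [forceValue, hj, hi]
    · simp only [forceValue, if_neg hj, Finset.mem_erase]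
      exact ⟨fun e => hj (σ.injective (e.trans hi.symm)), h j⟩

/-- The Brègman–Minc bound, for a set `S` of active rows such that the values of the other rows are
forced and not available to the active rows. The proof is Schrijver's: the convexity of `x log x`
is applied to the expansion along every active row, and the resulting bounds are averaged. -/
theorem log_card_permsIn_le {V : Type*} [Fintype V] [DecidableEq V] (m : ℕ) (S : Finset V)
    (hm : S.card = m) (N : V → Finset V) (h1 : ∀ i ∉ S, (N i).card ≤ 1)
    (h2 : ∀ i ∉ S, ∀ j ∈ S, Disjoint (N i) (N j)) (hne : (permsIn N).Nonempty) :
    Real.log (permsIn N).card ≤ ∑ j ∈ S, logFactorialDiv (N j).card := by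
  induction m generalizing S N with
  | zero =>
    rw [Finset.card_eq_zero] at hm
    subst hm
    have : (permsIn N).card ≤ 1 := by
      rw [Finset.card_le_one]
      intro σ hσ τ hτ
      rw [mem_permsIn] at hσ hτ
      ext i
      exact Finset.card_le_one.1 (h1 i (Finset.notMem_empty i)) _ (hσ i) _ (hτ i)
    rw [Finset.sum_empty]
    apply Real.log_nonpos (by positivity)
    exact_mod_cast this
  | succ m ih =>
    set M := permsIn N with hM
    have hMpos : (0 : ℝ) < M.card := by exact_mod_cast Finset.card_pos.2 hne
    let t : V → V → ℝ := fun i k => (permsIn (forceValue N i k)).card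
    have hfilter : ∀ i, ∀ k ∈ N i, permsIn (forceValue N i k) = M.filter fun σ => σ i = k := by
      intro i k hk
      ext σ
      rw [mem_permsIn_forceValue hk, Finset.mem_filter]
    have hmaps : ∀ i, ∀ σ ∈ M, σ i ∈ N i := fun i σ hσ => mem_permsIn.1 hσ i
    have hsum : ∀ i, ∑ k ∈ N i, t i k = M.card := by
      intro i
      rw [Finset.card_eq_sum_card_fiberwise (f := fun σ : Equiv.Perm V => σ i) (t := N i) (hmaps i)]
      push_cast
      exact Finset.sum_congr rfl fun k hk => by simp only [t, hfilter i k hk]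
    have hsum2 : ∀ i, ∑ k ∈ N i, t i k * Real.log (t i k) = ∑ σ ∈ M, Real.log (t i (σ i)) := by
      intro i
      rw [← Finset.sum_fiberwise_of_maps_to (hmaps i)]
      refine Finset.sum_congr rfl fun k hk => ?_
      rw [Finset.sum_congr rfl (g := fun _ => Real.log (t i k))
        (fun σ hσ => by rw [(Finset.mem_filter.1 hσ).2]), Finset.sum_const, nsmul_eq_mul,
        ← hfilter i k hk]
    -- the inductive hypothesis after fixing the value of one active row
    have hind : ∀ σ ∈ M, ∀ i ∈ S, Real.log (t i (σ i)) ≤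
        ∑ j ∈ S.erase i, logFactorialDiv ((N j).erase (σ i)).card := by
      intro σ hσ i hi
      have hk := hmaps i σ hσ
      refine (ih (S.erase i) (by rw [Finset.card_erase_of_mem hi, hm]; rfl)
        (forceValue N i (σ i)) ?_ ?_ ?_).trans (le_of_eq ?_)
      · intro j hj
        by_cases hji : j = i
        · simp [forceValue, hji]
        · simp only [forceValue, if_neg hji]
          exact (Finset.card_le_card (Finset.erase_subset _ _)).trans
            (h1 j fun hjS => hj (Finset.mem_erase.2 ⟨hji, hjS⟩))
      · intro j hj l hl
        have hli : l ≠ i := (Finset.mem_erase.1 hl).1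
        by_cases hji : j = i
        · simp [forceValue, hji, hli]
        · simp only [forceValue, if_neg hji, if_neg hli]
          exact (h2 j (fun hjS => hj (Finset.mem_erase.2 ⟨hji, hjS⟩)) l
            (Finset.mem_erase.1 hl).2).mono (Finset.erase_subset _ _) (Finset.erase_subset _ _)
      · exact ⟨σ, (mem_permsIn_forceValue hk).2 ⟨hσ, rfl⟩⟩
      · refine Finset.sum_congr rfl fun j hj => ?_
        simp only [forceValue, if_neg (Finset.mem_erase.1 hj).1]
    have hrow : ∀ i ∈ S, (M.card : ℝ) * Real.log M.card ≤
        ∑ σ ∈ M, (Real.log (N i).card +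
          ∑ j ∈ S.erase i, logFactorialDiv ((N j).erase (σ i)).card) := by
      intro i hi
      have h := sum_mul_log_sum_le (N i) (t i) (fun k _ => by simp [t]) (by rw [hsum]; exact hMpos)
      rw [hsum, hsum2] at h
      refine h.trans ?_
      rw [Finset.sum_add_distrib, Finset.sum_const, nsmul_eq_mul]
      gcongr with σ hσ
      exact hind σ hσ i hi
    -- each active row `j` loses one choice for `r - 1` of the other active rows, where `r = |N j|`
    have hcount : ∀ σ ∈ M, ∑ i ∈ S, (Real.log (N i).card +
          ∑ j ∈ S.erase i, logFactorialDiv ((N j).erase (σ i)).card) =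
        (S.card : ℝ) * ∑ j ∈ S, logFactorialDiv (N j).card := by
      intro σ hσ
      rw [Finset.sum_add_distrib, Finset.sum_comm' (t' := S) (s' := fun j => S.erase j)
        (by intro x y; simp only [Finset.mem_erase]; tauto), ← Finset.sum_add_distrib,
        Finset.mul_sum]
      refine Finset.sum_congr rfl fun j hj => ?_
      have hjj := hmaps j σ hσ
      have himage : ((S.erase j).filter fun i => σ i ∈ N j).card = (N j).card - 1 := by
        rw [← Finset.card_erase_of_mem hjj]
        apply Finset.card_bij fun i _ => σ i
        · intro i hi
          simp only [Finset.mem_filter, Finset.mem_erase] at hi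
          exact Finset.mem_erase.2 ⟨fun e => hi.1.1 (σ.injective e), hi.2⟩
        · intro i _ l _ e
          exact σ.injective e
        · intro y hy
          obtain ⟨hy1, hy2⟩ := Finset.mem_erase.1 hy
          refine ⟨σ.symm y, ?_, by simp⟩
          simp only [Finset.mem_filter, Finset.mem_erase, Equiv.apply_symm_apply]
          refine ⟨⟨fun e => hy1 (by rw [← e]; simp), ?_⟩, hy2⟩
          by_contra hS
          have := hmaps (σ.symm y) σ hσ
          rw [Equiv.apply_symm_apply] at this
          exact Finset.disjoint_left.1 (h2 _ hS j hj) this hy2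
      have hrpos : 1 ≤ (N j).card := Finset.card_pos.2 ⟨_, hjj⟩
      have hsplit := Finset.card_filter_add_card_filter_not (s := S.erase j)
        (fun i => σ i ∈ N j)
      rw [himage, Finset.card_erase_of_mem hj] at hsplit
      have hSpos : 1 ≤ S.card := Finset.card_pos.2 ⟨_, hj⟩
      rw [← Finset.sum_filter_add_sum_filter_not (S.erase j) (fun i => σ i ∈ N j)]
      rw [Finset.sum_congr rfl (g := fun _ => logFactorialDiv ((N j).card - 1))
        (fun i hi => by rw [Finset.card_erase_of_mem (Finset.mem_filter.1 hi).2]),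
        Finset.sum_congr (s₁ := (S.erase j).filter fun i => ¬ σ i ∈ N j) rfl
        (g := fun _ => logFactorialDiv (N j).card)
        (fun i hi => by rw [Finset.erase_eq_of_notMem (Finset.mem_filter.1 hi).2]),
        Finset.sum_const, Finset.sum_const, nsmul_eq_mul, nsmul_eq_mul, himage,
        mul_logFactorialDiv]
      have e1 : ((((S.erase j).filter fun i => ¬ σ i ∈ N j).card : ℕ) : ℝ) =
          S.card - (N j).card := by
        have : ((S.erase j).filter fun i => ¬ σ i ∈ N j).card + (N j).card = S.card := by omega
        rw [← this]; push_cast; ring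
      have e2 : Real.log (N j).card + Real.log (((N j).card - 1).factorial) =
          (N j).card * logFactorialDiv (N j).card := by
        rw [mul_logFactorialDiv, ← Nat.mul_factorial_pred (by omega : (N j).card ≠ 0)]
        push_cast
        rw [Real.log_mul (by positivity) (by positivity)]
      rw [e1, ← add_assoc, e2]
      ring
    have htotal : (S.card : ℝ) * (M.card * Real.log M.card) ≤
        S.card * (M.card * ∑ j ∈ S, logFactorialDiv (N j).card) := by
      calc (S.card : ℝ) * (M.card * Real.log M.card)
          = ∑ i ∈ S, (M.card * Real.log M.card) := by rw [Finset.sum_const, nsmul_eq_mul]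
        _ ≤ ∑ i ∈ S, ∑ σ ∈ M, (Real.log (N i).card +
              ∑ j ∈ S.erase i, logFactorialDiv ((N j).erase (σ i)).card) := Finset.sum_le_sum hrow
        _ = ∑ σ ∈ M, (S.card : ℝ) * ∑ j ∈ S, logFactorialDiv (N j).card := by
            rw [Finset.sum_comm]
            exact Finset.sum_congr rfl hcount
        _ = _ := by rw [Finset.sum_const, nsmul_eq_mul]; ring
    have hS0 : (0 : ℝ) < S.card := by rw [hm]; positivity
    exact le_of_mul_le_mul_left (le_of_mul_le_mul_left htotal hS0) hMpos

/-- The Brègman–Minc bound for a relation whose rows all have `a` elements. -/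
theorem card_permsIn_le {n a : ℕ} (N : Fin n → Finset (Fin n)) (hrow : ∀ i, (N i).card = a) :
    ((permsIn N).card : ℝ) ≤ (a.factorial : ℝ) ^ ((n : ℝ) / a) := by
  rcases (permsIn N).eq_empty_or_nonempty with h | h
  · rw [h]; simp; positivity
  have hc : (0 : ℝ) < (permsIn N).card := by exact_mod_cast Finset.card_pos.2 h
  have := log_card_permsIn_le n Finset.univ (by simp) N (by simp) (by simp) h
  rw [← Real.log_le_log_iff hc (by positivity), Real.log_rpow (by positivity)]
  refine this.trans (le_of_eq ?_)
  simp only [hrow, Finset.sum_const, Finset.card_univ, Fintype.card_fin, nsmul_eq_mul,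
    logFactorialDiv]
  ring

/-! ### Stirling's formula with an explicit upper bound -/

/-- The sequence `log (stirlingSeq n) - 1 / (12 n)` increases to `log √π`. -/
theorem log_stirlingSeq_le {n : ℕ} (hn : 1 ≤ n) :
    Real.log (Stirling.stirlingSeq n) ≤ Real.log (√Real.pi) + 1 / (12 * n) := by
  let u : ℕ → ℝ := fun m => Real.log (Stirling.stirlingSeq (m + 1)) - 1 / (12 * ((m + 1 : ℕ) : ℝ))
  have hmono : Monotone u := by
    refine monotone_nat_of_le_succ fun m => ?_
    have h := Stirling.log_stirlingSeq_sdiff_le (m + 1)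
    have e : (1 : ℝ) / (12 * ((m + 1 : ℕ) : ℝ) * (((m + 1 : ℕ) : ℝ) + 1)) =
        1 / (12 * ((m + 1 : ℕ) : ℝ)) - 1 / (12 * ((m + 1 + 1 : ℕ) : ℝ)) := by
      push_cast
      field_simp
      ring
    rw [e] at h
    simp only [u]
    linarith
  have hlim : Filter.Tendsto u Filter.atTop (nhds (Real.log (√Real.pi) - 0)) := by
    refine Filter.Tendsto.sub ?_ ?_
    · have h1 := Stirling.tendsto_stirlingSeq_sqrt_pi.comp (Filter.tendsto_add_atTop_nat 1)
      exact (Real.continuousAt_log (by positivity)).tendsto.comp h1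
    · refine (Filter.tendsto_add_atTop_iff_nat (f := fun m : ℕ => 1 / (12 * (m : ℝ))) 1).2 ?_
      exact tendsto_const_nhds.div_atTop
        (tendsto_natCast_atTop_atTop.const_mul_atTop (by norm_num : (0 : ℝ) < 12))
  have h := hmono.ge_of_tendsto hlim (n - 1)
  simp only [u, Nat.sub_add_cancel hn, sub_zero] at h
  linarith

theorem factorial_le_stirling {n : ℕ} (hn : 1 ≤ n) :
    (n.factorial : ℝ) ≤ √(2 * Real.pi * n) * Real.exp (1 / (12 * (n : ℝ))) *
      ((n : ℝ) / Real.exp 1) ^ n := by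
  have hn0 : (0 : ℝ) < n := by exact_mod_cast hn
  have hs : 0 < Stirling.stirlingSeq n := by unfold Stirling.stirlingSeq; positivity
  have h := Real.exp_le_exp.2 (log_stirlingSeq_le hn)
  rw [Real.exp_log hs, Real.exp_add, Real.exp_log (by positivity), Stirling.stirlingSeq,
    div_le_iff₀ (by positivity)] at h
  refine h.trans (le_of_eq ?_)
  rw [show 2 * Real.pi * (n : ℝ) = Real.pi * (2 * n) by ring, Real.sqrt_mul Real.pi_pos.le]
  ring

theorem card_permsIn_le_stirling {n a : ℕ} (ha : 1 ≤ a) (N : Fin n → Finset (Fin n))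
    (hrow : ∀ i, (N i).card = a) :
    ((permsIn N).card : ℝ) ≤
      (√(2 * Real.pi * a) * Real.exp (1 / (12 * (a : ℝ)))) ^ ((n : ℝ) / a) *
        ((a : ℝ) / Real.exp 1) ^ n := by
  have ha0 : (0 : ℝ) < a := by exact_mod_cast ha
  refine (card_permsIn_le N hrow).trans ((Real.rpow_le_rpow (by positivity)
    (factorial_le_stirling ha) (by positivity)).trans (le_of_eq ?_))
  rw [Real.mul_rpow (by positivity) (by positivity), ← Real.rpow_natCast ((a : ℝ) / Real.exp 1) a,
    ← Real.rpow_mul (by positivity), mul_div_cancel₀ _ ha0.ne', Real.rpow_natCast]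

/-- The relative error of `log a` as an approximation of `2 log (√(2 π a) exp (1 / (12 a)))`. -/
noncomputable def stirlingError (a : ℕ) : ℝ :=
  (Real.log (2 * Real.pi) + 1 / (6 * (a : ℝ))) / Real.log a

theorem tendsto_stirlingError : Filter.Tendsto stirlingError Filter.atTop (nhds 0) := by
  unfold stirlingError
  refine Filter.Tendsto.div_atTop (a := Real.log (2 * Real.pi) + 0) ?_
    (Real.tendsto_log_atTop.comp tendsto_natCast_atTop_atTop)
  exact tendsto_const_nhds.add (tendsto_const_nhds.div_atTop
    (tendsto_natCast_atTop_atTop.const_mul_atTop (by norm_num : (0 : ℝ) < 6)))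

theorem stirling_rpow_eq_two_rpow {a : ℕ} (ha : 2 ≤ a) (b : ℝ) :
    (√(2 * Real.pi * a) * Real.exp (1 / (12 * (a : ℝ)))) ^ (b / a) =
      (2 : ℝ) ^ ((1 + stirlingError a) * Real.logb 2 a * (b / (2 * a))) := by
  have ha1 : (1 : ℝ) < a := by exact_mod_cast ha
  have ha0 : (0 : ℝ) < a := by linarith
  have hlog : Real.log a ≠ 0 := (Real.log_pos ha1).ne'
  have hlog2 : Real.log 2 ≠ 0 := (Real.log_pos one_lt_two).ne'
  rw [Real.rpow_def_of_pos (by positivity), Real.rpow_def_of_pos two_pos,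
    Real.log_mul (by positivity) (by positivity), Real.log_exp, Real.log_sqrt (by positivity),
    Real.log_mul (by positivity) ha0.ne', stirlingError, Real.logb]
  congr 1
  field_simp
  ring

/-! ### Perfect matchings of a bipartite graph as permutations -/

section BipartiteGraph

variable {V : Type*} {G : SimpleGraph V} {A B : Set V} {b : ℕ}

/-- The perfect matching that joins `α i` to `β (σ i)` for all `i`. -/
def matchingOfPerm (G : SimpleGraph V) (α : Fin b ≃ A) (β : Fin b ≃ B) (σ : Equiv.Perm (Fin b))
    (h : ∀ i, G.Adj (α i) (β (σ i))) : G.Subgraph where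
  verts := Set.univ
  Adj u v := ∃ i, (u = α i ∧ v = β (σ i)) ∨ (v = α i ∧ u = β (σ i))
  adj_sub := by
    rintro u v ⟨i, ⟨rfl, rfl⟩ | ⟨rfl, rfl⟩⟩
    · exact h i
    · exact (h i).symm
  edge_vert := fun _ => Set.mem_univ _
  symm := ⟨fun u v ⟨i, hi⟩ => ⟨i, hi.symm⟩⟩

theorem matchingOfPerm_adj_iff (hAB : Disjoint A B) (α : Fin b ≃ A) (β : Fin b ≃ B)
    (σ : Equiv.Perm (Fin b)) (h : ∀ i, G.Adj (α i) (β (σ i))) (i j : Fin b) :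
    (matchingOfPerm G α β σ h).Adj (α i) (β j) ↔ j = σ i := by
  constructor
  · rintro ⟨l, ⟨h1, h2⟩ | ⟨h1, h2⟩⟩
    · rw [α.injective (Subtype.ext h1), β.injective (Subtype.ext h2)]
    · exact absurd (h2 ▸ (β (σ l)).2) (Set.disjoint_left.1 hAB (α i).2)
  · rintro rfl
    exact ⟨i, Or.inl ⟨rfl, rfl⟩⟩

theorem matchingOfPerm_isPerfectMatching (hAB : Disjoint A B) (hU : A ∪ B = Set.univ)
    (α : Fin b ≃ A) (β : Fin b ≃ B)
    (σ : Equiv.Perm (Fin b)) (h : ∀ i, G.Adj (α i) (β (σ i))) :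
    (matchingOfPerm G α β σ h).IsPerfectMatching := by
  rw [SimpleGraph.Subgraph.isPerfectMatching_iff]
  intro v
  rcases (Set.ext_iff.1 hU v).2 (Set.mem_univ v) with hv | hv
  · obtain ⟨i, hi⟩ := α.surjective ⟨v, hv⟩
    have hi : v = α i := by rw [hi]
    refine ⟨β (σ i), ⟨i, Or.inl ⟨hi, rfl⟩⟩, ?_⟩
    rintro w ⟨l, ⟨h1, h2⟩ | ⟨h1, h2⟩⟩
    · rw [h2, α.injective (Subtype.ext (hi.symm.trans h1))]
    · exact absurd (h2 ▸ (β (σ l)).2) (Set.disjoint_left.1 hAB hv)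
  · obtain ⟨j, hj⟩ := β.surjective ⟨v, hv⟩
    have hj : v = β j := by rw [hj]
    refine ⟨α (σ.symm j), ⟨σ.symm j, Or.inr ⟨rfl, by simpa using hj⟩⟩, ?_⟩
    rintro w ⟨l, ⟨h1, h2⟩ | ⟨h1, h2⟩⟩
    · exact absurd hv (Set.disjoint_left.1 hAB (h1 ▸ (α l).2))
    · rw [h1, β.injective (Subtype.ext (hj.symm.trans h2)), Equiv.symm_apply_apply]

open Classical in
theorem numPerfectMatchings_eq_card_permsIn (hG : G.IsBipartiteWith A B)
    (hU : A ∪ B = Set.univ) (α : Fin b ≃ A) (β : Fin b ≃ B) :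
    numPerfectMatchings G =
      (permsIn fun i => Finset.univ.filter fun j => G.Adj (α i) (β j)).card := by
  set N : Fin b → Finset (Fin b) := fun i => Finset.univ.filter fun j => G.Adj (α i) (β j) with hN
  have hAB := hG.disjoint
  have hadj : ∀ σ ∈ permsIn N, ∀ i, G.Adj (α i) (β (σ i)) := fun σ hσ i => by
    simpa [hN] using mem_permsIn.1 hσ i
  let Φ : {σ // σ ∈ permsIn N} → {M : G.Subgraph // M.IsPerfectMatching} := fun σ =>
    ⟨matchingOfPerm G α β σ.1 (hadj σ.1 σ.2),
      matchingOfPerm_isPerfectMatching hAB hU α β σ.1 (hadj σ.1 σ.2)⟩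
  have hΦ : Function.Bijective Φ := by
    constructor
    · rintro ⟨σ, hσ⟩ ⟨τ, hτ⟩ he
      have he' : matchingOfPerm G α β σ (hadj σ hσ) = matchingOfPerm G α β τ (hadj τ hτ) :=
        congrArg Subtype.val he
      ext i
      have h1 := (matchingOfPerm_adj_iff hAB α β σ (hadj σ hσ) i (σ i)).2 rfl
      rw [he', matchingOfPerm_adj_iff hAB] at h1
      exact congrArg Fin.val h1
    · rintro ⟨M, hM⟩
      have hM' := SimpleGraph.Subgraph.isPerfectMatching_iff.1 hM
      have hex : ∀ i, ∃ j, M.Adj (α i) (β j) := by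
        intro i
        obtain ⟨w, hw, -⟩ := hM' (α i)
        have hwB : w ∈ B := hG.mem_of_mem_adj (α i).2 (M.adj_sub hw)
        obtain ⟨j, hj⟩ := β.surjective ⟨w, hwB⟩
        exact ⟨j, by rw [hj]; exact hw⟩
      choose f hf using hex
      have hinj : Function.Injective f := by
        intro i l he
        have h1 := (hf i).symm
        rw [he] at h1
        exact α.injective (Subtype.ext ((hM' _).unique h1 (hf l).symm))
      let σ : Equiv.Perm (Fin b) := Equiv.ofBijective f (Finite.injective_iff_bijective.1 hinj)
      have hσ : σ ∈ permsIn N :=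
        mem_permsIn.2 fun i => by simpa [hN] using (M.adj_sub (hf i) : G.Adj (α i) (β (σ i)))
      refine ⟨⟨σ, hσ⟩, Subtype.ext (SimpleGraph.Subgraph.ext ?_ ?_)⟩
      · exact (SimpleGraph.Subgraph.isSpanning_iff.1 hM.2).symm
      · funext u v
        refine propext ⟨?_, fun huv => ?_⟩
        · rintro ⟨i, ⟨rfl, rfl⟩ | ⟨rfl, rfl⟩⟩
          · exact hf i
          · exact (hf i).symm
        · rcases hG.mem_of_adj (M.adj_sub huv) with ⟨hu, -⟩ | ⟨-, hv⟩
          · obtain ⟨i, hi⟩ := α.surjective ⟨u, hu⟩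
            have hi : u = α i := by rw [hi]
            rw [hi] at huv
            exact ⟨i, Or.inl ⟨hi, (hM' _).unique huv (hf i)⟩⟩
          · obtain ⟨i, hi⟩ := α.surjective ⟨v, hv⟩
            have hi : v = α i := by rw [hi]
            rw [hi] at huv
            exact ⟨i, Or.inr ⟨hi, (hM' _).unique huv.symm (hf i)⟩⟩
  rw [numPerfectMatchings, ← Nat.card_eq_of_bijective Φ hΦ]
  simp

open Classical in
/-- The number of perfect matchings of a regular bipartite graph with classes of size `b` is the
number of permutations in a relation with all row and column sums `a`. -/
theorem exists_numPerfectMatchings_eq_card_permsIn [Fintype V] [DecidableRel G.Adj]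
    (hG : G.IsBipartiteWith A B) (hU : A ∪ B = Set.univ) (hA : A.ncard = b) (hB : B.ncard = b)
    {a : ℕ} (hreg : G.IsRegularOfDegree a) :
    ∃ N : Fin b → Finset (Fin b), (∀ i, (N i).card = a) ∧
      (∀ j, (Finset.univ.filter fun i => j ∈ N i).card = a) ∧
      numPerfectMatchings G = (permsIn N).card := by
  have α : Fin b ≃ A := (Finite.equivFinOfCardEq hA).symm
  have β : Fin b ≃ B := (Finite.equivFinOfCardEq hB).symm
  refine ⟨_, fun i => ?_, fun j => ?_, numPerfectMatchings_eq_card_permsIn hG hU α β⟩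
  · rw [← hreg (α i), ← SimpleGraph.card_neighborFinset_eq_degree]
    refine Finset.card_bij (fun j _ => (β j : V)) ?_ ?_ ?_
    · intro j hj
      simpa using hj
    · intro j _ l _ he
      exact β.injective (Subtype.ext he)
    · intro w hw
      rw [SimpleGraph.mem_neighborFinset] at hw
      obtain ⟨j, hj⟩ := β.surjective ⟨w, hG.mem_of_mem_adj (α i).2 hw⟩
      exact ⟨j, by simpa [hj] using hw, by rw [hj]⟩
  · rw [← hreg (β j), ← SimpleGraph.card_neighborFinset_eq_degree]
    refine Finset.card_bij (fun i _ => (α i : V)) ?_ ?_ ?_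
    · intro i hi
      simpa [G.adj_comm] using hi
    · intro j _ l _ he
      exact α.injective (Subtype.ext he)
    · intro w hw
      rw [SimpleGraph.mem_neighborFinset] at hw
      obtain ⟨i, hi⟩ := α.surjective ⟨w, hG.symm.mem_of_mem_adj (β j).2 hw⟩
      exact ⟨i, by simpa [hi] using hw.symm, by rw [hi]⟩

theorem exp_mul_pow_le_numPerfectMatchings [Fintype V] [DecidableRel G.Adj]
    (hG : G.IsBipartiteWith A B) (hU : A ∪ B = Set.univ) (hA : A.ncard = b) (hB : B.ncard = b)
    {a : ℕ} (ha : 1 ≤ a) (hreg : G.IsRegularOfDegree a) :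
    Real.exp ((b : ℝ) / (2 * a)) * ((a : ℝ) / Real.exp 1) ^ b ≤ numPerfectMatchings G := by
  obtain ⟨N, hrow, hcol, h⟩ := exists_numPerfectMatchings_eq_card_permsIn hG hU hA hB hreg
  rw [h]
  exact exp_mul_pow_le_card_permsIn ha N hrow hcol

theorem numPerfectMatchings_le_stirling [Fintype V] [DecidableRel G.Adj]
    (hG : G.IsBipartiteWith A B) (hU : A ∪ B = Set.univ) (hA : A.ncard = b) (hB : B.ncard = b)
    {a : ℕ} (ha : 1 ≤ a) (hreg : G.IsRegularOfDegree a) :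
    (numPerfectMatchings G : ℝ) ≤
      (√(2 * Real.pi * a) * Real.exp (1 / (12 * (a : ℝ)))) ^ ((b : ℝ) / a) *
        ((a : ℝ) / Real.exp 1) ^ b := by
  obtain ⟨N, hrow, -, h⟩ := exists_numPerfectMatchings_eq_card_permsIn hG hU hA hB hreg
  rw [h]
  exact card_permsIn_le_stirling ha N hrow

end BipartiteGraph

/-! ### The hypercube -/

/-- Flipping coordinate `i` of a vertex of the hypercube. -/
def flipCoord {d : ℕ} (i : Fin d) (x : Fin d → Bool) : Fin d → Bool := Function.update x i (!x i)

theorem flipCoord_flipCoord {d : ℕ} (i : Fin d) (x : Fin d → Bool) :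
    flipCoord i (flipCoord i x) = x := by
  simp [flipCoord]

theorem flipCoord_injective {d : ℕ} (x : Fin d → Bool) :
    Function.Injective fun i => flipCoord i x := by
  intro i j h
  by_contra hij
  have := congrFun h i
  simp [flipCoord, Function.update_of_ne hij] at this

theorem hypercubeGraph_adj_iff {d : ℕ} (x y : Fin d → Bool) :
    (hypercubeGraph d).Adj x y ↔ ∃ i, y = flipCoord i x := by
  change hammingDist x y = 1 ↔ _
  rw [hammingDist, Finset.card_eq_one]
  constructor
  · rintro ⟨i, hi⟩
    refine ⟨i, funext fun j => ?_⟩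
    have hj : x j ≠ y j ↔ j = i := by
      simpa using Finset.ext_iff.1 hi j
    by_cases hji : j = i
    · subst hji
      have h1 := hj.2 rfl
      simp only [flipCoord, Function.update_self]
      cases hx : x j <;> cases hy : y j <;> simp_all
    · have h1 := not_not.1 (mt hj.1 hji)
      simp [flipCoord, Function.update_of_ne hji, h1]
  · rintro ⟨i, rfl⟩
    refine ⟨i, ?_⟩
    ext j
    by_cases hji : j = i
    · rw [Finset.mem_filter]
      subst hji
      simp [flipCoord]
    · rw [Finset.mem_filter]
      simp [flipCoord, hji]

/-- The parity of the number of coordinates equal to `true`. -/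
def parity {d : ℕ} (x : Fin d → Bool) : ZMod 2 := ∑ i, if x i then 1 else 0

theorem parity_flipCoord {d : ℕ} (i : Fin d) (x : Fin d → Bool) :
    parity (flipCoord i x) = parity x + 1 := by
  rw [parity, parity, ← Finset.add_sum_erase _ _ (Finset.mem_univ i),
    ← Finset.add_sum_erase Finset.univ (fun j => if x j then (1 : ZMod 2) else 0)
      (Finset.mem_univ i)]
  have h1 : ∑ j ∈ Finset.univ.erase i, (if flipCoord i x j then (1 : ZMod 2) else 0) =
      ∑ j ∈ Finset.univ.erase i, (if x j then (1 : ZMod 2) else 0) := by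
    refine Finset.sum_congr rfl fun j hj => ?_
    rw [flipCoord, Function.update_of_ne (Finset.mem_erase.1 hj).1]
  have h2 : (if flipCoord i x i then (1 : ZMod 2) else 0) = (if x i then (1 : ZMod 2) else 0) + 1 := by
    simp only [flipCoord, Function.update_self]
    cases x i
    · simp
    · simp [CharTwo.add_self_eq_zero]
  rw [h1, h2]
  ring

theorem hypercubeGraph_isBipartiteWith (d : ℕ) :
    (hypercubeGraph d).IsBipartiteWith {x | parity x = 0} {x | parity x = 1} where
  disjoint := Set.disjoint_left.2 fun x (h0 : parity x = 0) (h1 : parity x = 1) =>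
    zero_ne_one (h0.symm.trans h1)
  mem_of_adj := by
    intro x y h
    obtain ⟨i, rfl⟩ := (hypercubeGraph_adj_iff x y).1 h
    have h01 : ∀ z : ZMod 2, (z = 0 ∧ z + 1 = 1) ∨ (z = 1 ∧ z + 1 = 0) := by decide
    simpa [parity_flipCoord] using h01 (parity x)

theorem parity_union_eq_univ (d : ℕ) :
    {x : Fin d → Bool | parity x = 0} ∪ {x | parity x = 1} = Set.univ := by
  have h01 : ∀ z : ZMod 2, z = 0 ∨ z = 1 := by decide
  exact Set.eq_univ_of_forall fun x => h01 (parity x)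

theorem ncard_parity {d : ℕ} (hd : 1 ≤ d) :
    {x : Fin d → Bool | parity x = 0}.ncard = 2 ^ (d - 1) ∧
      {x : Fin d → Bool | parity x = 1}.ncard = 2 ^ (d - 1) := by
  let i : Fin d := ⟨0, hd⟩
  have heq : {x : Fin d → Bool | parity x = 0}.ncard = {x : Fin d → Bool | parity x = 1}.ncard := by
    refine Set.ncard_congr (fun x _ => flipCoord i x) ?_ ?_ ?_
    · intro x hx
      have hx : parity x = 0 := hx
      change parity (flipCoord i x) = 1
      rw [parity_flipCoord, hx, zero_add]
    · intro x y _ _ h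
      rw [← flipCoord_flipCoord i x, h, flipCoord_flipCoord]
    · intro y hy
      have hy : parity y = 1 := hy
      refine ⟨flipCoord i y, ?_, flipCoord_flipCoord i y⟩
      change parity (flipCoord i y) = 0
      rw [parity_flipCoord, hy]
      decide
  have hsum := Set.ncard_union_eq (hypercubeGraph_isBipartiteWith d).disjoint
  rw [parity_union_eq_univ, Set.ncard_univ, Nat.card_eq_fintype_card, Fintype.card_fun,
    Fintype.card_bool, Fintype.card_fin] at hsum
  obtain ⟨e, rfl⟩ : ∃ e, d = e + 1 := ⟨d - 1, by omega⟩
  rw [pow_succ] at hsum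
  simp only [Nat.add_sub_cancel]
  omega

open Classical in
theorem hypercubeGraph_isRegularOfDegree (d : ℕ) : (hypercubeGraph d).IsRegularOfDegree d := by
  intro x
  have : (hypercubeGraph d).neighborFinset x = Finset.univ.image fun i => flipCoord i x := by
    ext y
    simp [SimpleGraph.mem_neighborFinset, hypercubeGraph_adj_iff, eq_comm]
  rw [← SimpleGraph.card_neighborFinset_eq_degree, this,
    Finset.card_image_of_injective _ (flipCoord_injective x), Finset.card_univ, Fintype.card_fin]

theorem proposition1p3 :
    -- (i) the two bounds for regular bipartite graphs
    (∀ (V : Type*) [Fintype V] (G : SimpleGraph V) [DecidableRel G.Adj] (A B : Set V) (a b : ℕ),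
      G.IsBipartiteWith A B → A ∪ B = Set.univ → A.ncard = b → B.ncard = b →
      2 ≤ a → G.IsRegularOfDegree a →
        Real.exp ((b : ℝ) / (2 * a)) * ((a : ℝ) / Real.exp 1) ^ b
            ≤ (numPerfectMatchings G : ℝ) ∧
        (numPerfectMatchings G : ℝ)
            ≤ (Real.sqrt (2 * Real.pi * a) * Real.exp (1 / (12 * (a : ℝ)))) ^ ((b : ℝ) / a)
                * ((a : ℝ) / Real.exp 1) ^ b) ∧
    -- (i) the asymptotic form of the upper bound, when both `a` and `b` tend to infinity
    (∃ ε : ℕ × ℕ → ℝ, Filter.Tendsto ε Filter.atTop (nhds 0) ∧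
      ∀ a b : ℕ, 2 ≤ a →
        (Real.sqrt (2 * Real.pi * a) * Real.exp (1 / (12 * (a : ℝ)))) ^ ((b : ℝ) / a)
            * ((a : ℝ) / Real.exp 1) ^ b
          = (2 : ℝ) ^ ((1 + ε (a, b)) * Real.logb 2 a * ((b : ℝ) / (2 * a)))
            * ((a : ℝ) / Real.exp 1) ^ b) ∧
    -- (ii) the lower bound for the hypercube, with `n = 2 ^ (d - 1)` and `N = (d / e) ^ n`
    (∀ d : ℕ, 1 ≤ d → ∀ n : ℕ, n = 2 ^ (d - 1) →
      Real.exp ((n : ℝ) / (2 * d)) * ((d : ℝ) / Real.exp 1) ^ n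
        ≤ (numPerfectMatchings (hypercubeGraph d) : ℝ)) ∧
    -- (ii) the upper bound for the hypercube
    (∃ ε : ℕ → ℝ, Filter.Tendsto ε Filter.atTop (nhds 0) ∧
      ∀ d : ℕ, 2 ≤ d → ∀ n : ℕ, n = 2 ^ (d - 1) →
        (numPerfectMatchings (hypercubeGraph d) : ℝ)
          ≤ (2 : ℝ) ^ ((1 + ε d) * Real.logb 2 d * ((n : ℝ) / (2 * d)))
            * ((d : ℝ) / Real.exp 1) ^ n) := by
  classical
  refine ⟨?_, ?_, ?_, ?_⟩
  · intro V _ G _ A B a b hG hU hA hB ha hreg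
    exact ⟨exp_mul_pow_le_numPerfectMatchings hG hU hA hB (by omega) hreg,
      numPerfectMatchings_le_stirling hG hU hA hB (by omega) hreg⟩
  · refine ⟨fun x => stirlingError x.1, ?_, fun a b ha => ?_⟩
    · rw [← Filter.prod_atTop_atTop_eq]
      exact tendsto_stirlingError.comp Filter.tendsto_fst
    · rw [stirling_rpow_eq_two_rpow ha]
  · rintro d hd n rfl
    exact exp_mul_pow_le_numPerfectMatchings (hypercubeGraph_isBipartiteWith d)
      (parity_union_eq_univ d) (ncard_parity hd).1 (ncard_parity hd).2 hd
      (hypercubeGraph_isRegularOfDegree d)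
  · refine ⟨stirlingError, tendsto_stirlingError, ?_⟩
    rintro d hd n rfl
    rw [← stirling_rpow_eq_two_rpow hd]
    exact numPerfectMatchings_le_stirling (hypercubeGraph_isBipartiteWith d)
      (parity_union_eq_univ d) (ncard_parity (by omega)).1 (ncard_parity (by omega)).2 (by omega)
      (hypercubeGraph_isRegularOfDegree d)
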